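/- A monoid $M$ is sofic if for every finite $K\subseteq M$ and $\varepsilon>0$ there are a non-empty finite set $X$ and a map $M\times X\to X$, $(m,x)\mapsto m\cdot x$, such that $1\cdot x=x$ for all $x\in X$; for all $g,h\in K$ the proportion of $x\in X$ with $g\cdot(h\cdot x)=(gh)\cdot x$ is at least $1-\varepsilon$; and for all distinct $g,h\in K$ the proportion of $x\in X$ with $g\cdot x=h\cdot x$ is at most $\varepsilon$. A group is sofic if it is sofic as a monoid, and amenable if it admits a finitely additive probability measure, defined on all its subsets, that is invariant under left translation. A monoid $M$ is regular if for every $x\in M$ there is $y\in M$ with $xyx=x$. A subgroup of $M$ is a subsemigroup that is a group under the multiplication of $M$; its identity element may be any idempotent of $M$. On $M$, $x\mathrel{\mathcal L}y$ means $Mx=My$, $x\mathrel{\mathcal R}y$ means $xM=yM$, and $x\mathrel{\mathcal D}y$ means that $x\mathrel{\mathcal L}z$ and $z\mathrel{\mathcal R}y$ for some $z\in M$. **Corollary 4.3.** Let $M$ be a regular monoid such that the group of units of $M$ is sofic, every subgroup of $M$ consisting of non-units is amenable, and each $\mathcal D$-class of $M$ contains only finitely many $\mathcal L$-classes. Then $M$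 is sofic. -/

import Mathlib

/-- The proportion of elements of the finite type `X` that satisfy `p`. -/
noncomputable def proportion (X : Type) (p : X → Prop) : ℝ :=
  (Set.ncard {x : X | p x} : ℝ) / (Nat.card X : ℝ)

/-- A map `M × X → X` is a (left) `(K, ε)`-action of the monoid `M` on `X`. -/
structure IsApproxAction {M : Type*} [Monoid M] (K : Finset M) (ε : ℝ) (X : Type)
    (act : M → X → X) : Prop where
  one_act : ∀ x : X, act 1 x = x
  mul_act : ∀ g ∈ K, ∀ h ∈ K,
    1 - ε ≤ proportion X (fun x => act g (act h x) = act (g * h) x)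
  separates : ∀ g ∈ K, ∀ h ∈ K, g ≠ h →
    proportion X (fun x => act g x = act h x) ≤ ε

/-- A monoid is (left) sofic if it has a `(K, ε)`-action on some non-empty finite set for every
finite subset `K` and every `ε > 0`. -/
def IsSofic (M : Type*) [Monoid M] : Prop :=
  ∀ (K : Finset M) (ε : ℝ), 0 < ε →
    ∃ (X : Type) (_ : Finite X) (_ : Nonempty X) (act : M → X → X), IsApproxAction K ε X act

/-- A group is amenable if it has a finitely additive probability measure, defined on all of its
subsets, that is invariant under left translation. -/
def IsAmenable (G : Type*) [Group G] : Prop :=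
  ∃ μ : Set G → ℝ,
    (∀ A, 0 ≤ μ A) ∧
    μ Set.univ = 1 ∧
    (∀ A B, Disjoint A B → μ (A ∪ B) = μ A + μ B) ∧
    (∀ (g : G) (A : Set G), μ ((fun x => g * x) '' A) = μ A)

/-- Green's relation `ℒ`: `Mx = My`. -/
def GreenL {M : Type*} [Monoid M] (x y : M) : Prop :=
  Set.range (fun m : M => m * x) = Set.range (fun m : M => m * y)

/-- Green's relation `ℛ`: `xM = yM`. -/
def GreenR {M : Type*} [Monoid M] (x y : M) : Prop :=
  Set.range (fun m : M => x * m) = Set.range (fun m : M => y * m)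

/-- Green's relation `𝒟`: `x ℒ z` and `z ℛ y` for some `z`. -/
def GreenD {M : Type*} [Monoid M] (x y : M) : Prop :=
  ∃ z : M, GreenL x z ∧ GreenR z y

/-- The `ℒ`-class of an element. -/
def classL {M : Type*} [Monoid M] (x : M) : Set M := {y | GreenL x y}

/-- The `𝒟`-class of an element. -/
def classD {M : Type*} [Monoid M] (x : M) : Set M := {y | GreenD x y}

/-- A monoid is (von Neumann) regular. -/
def IsRegularMonoid (M : Type*) [Monoid M] : Prop :=
  ∀ x : M, ∃ y : M, x * y * x = x

/-- A subsemigroup of `M` is a subgroup of `M` (around the idempotent `e`, which need not be the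
identity element of `M`) if it is a group under the multiplication of `M`. -/
def IsSubgroupOf {M : Type*} [Monoid M] (S : Subsemigroup M) : Prop :=
  ∃ e ∈ S, (∀ x ∈ S, e * x = x ∧ x * e = x) ∧ ∀ x ∈ S, ∃ y ∈ S, y * x = e ∧ x * y = e

/-- The group structure of a subgroup of `M`; its multiplication is that of `M`. -/
noncomputable abbrev IsSubgroupOf.group {M : Type*} [Monoid M] {S : Subsemigroup M}
    (h : IsSubgroupOf S) : Group S :=
  letI : One S := ⟨⟨h.choose, h.choose_spec.1⟩⟩
  letI : Inv S := ⟨fun x => ⟨(h.choose_spec.2.2 x x.2).choose,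
    (h.choose_spec.2.2 x x.2).choose_spec.1⟩⟩
  Group.ofLeftAxioms (fun a b c => mul_assoc a b c)
    (fun x => Subtype.ext (h.choose_spec.2.1 x x.2).1)
    (fun x => Subtype.ext (h.choose_spec.2.2 x x.2).choose_spec.2.1)

-- Finiteness of the set of `ℒ`-classes in the `𝒟`-class of 1 makes one-sided units two-sided, so
-- the non-units form an ideal. Let G be the group of units. For a non-unit n, the orbit nG lies in
-- the `ℛ`-class of n and meets finitely many `ℒ`-classes; elements of the orbit in the same
-- `ℒ`-class differ by left multiplication by the amenable maximal subgroup Γ around an idempotent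
-- `n * y`. Hence G acts on nG through a wreath product of Γ with a finite symmetric group, and
-- Følner sets of Γ yield Følner sets of functions on G that separate the points of nG
-- (`exists_folner_of_not_isUnit`).
--
-- For finitely many n these give a finite approximate G-set Z with a map a : Z → G satisfying n
-- a(gz) = n g a(z) for most z (`exists_approx_equivariant`). Take a sofic approximation X of G,
-- many copies of X × Z, and a small finite set Y ⊆ M. Units act on X × Z, while a non-unit n sends
-- (x, z) to n a(z) in Y (`IsSofic.of_units`). Here X separates units, and right cancellation of
-- a(z) separates non-units.

universe u

/-! ### Følner sets from invariant means -/

open scoped Pointwise in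
-- Some translate by an element of `A` adds more than δ|F| new points to `F`, so multiplication by
-- `insert 1 A` expands by the factor 1 + δ; iterate.
theorem exists_pow_mul_card_le_card_mul {Γ : Type*} [Group Γ] [DecidableEq Γ] {A : Finset Γ}
    {δ : ℝ} (hδ : 0 ≤ δ)
    (h : ∀ F : Finset Γ, F.Nonempty →
      ∃ a ∈ A, δ * F.card < ((F.filter (fun x => a * x ∉ F)).card : ℝ)) (k : ℕ) :
    ∃ C : Finset Γ, ∀ F : Finset Γ, (1 + δ) ^ k * F.card ≤ ((C * F).card : ℝ) := by
  have step : ∀ F : Finset Γ, (1 + δ) * F.card ≤ ((insert 1 A * F).card : ℝ) := by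
    intro F
    rcases F.eq_empty_or_nonempty with rfl | hF
    · simp
    obtain ⟨a, ha, hlt⟩ := h F hF
    have hd : Disjoint F ((F.filter (fun x => a * x ∉ F)).image (a * ·)) := by
      rw [Finset.disjoint_left]
      intro x hx hx'
      simp only [Finset.mem_image, Finset.mem_filter] at hx'
      obtain ⟨y, ⟨_, hy⟩, rfl⟩ := hx'
      exact hy hx
    have hsub : F ∪ (F.filter (fun x => a * x ∉ F)).image (a * ·) ⊆ insert 1 A * F := by
      intro x hx
      rcases Finset.mem_union.1 hx with hx | hx
      · exact Finset.mem_mul.2 ⟨1, by simp, x, hx, by simp⟩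
      · simp only [Finset.mem_image, Finset.mem_filter] at hx
        obtain ⟨y, ⟨hy, _⟩, rfl⟩ := hx
        exact Finset.mem_mul.2 ⟨a, by simp [ha], y, hy, rfl⟩
    have hc := Finset.card_le_card hsub
    rw [Finset.card_union_of_disjoint hd,
      Finset.card_image_of_injective _ (mul_right_injective a)] at hc
    have hc' : (F.card : ℝ) + ((F.filter (fun x => a * x ∉ F)).card : ℝ) ≤
        ((insert 1 A * F).card : ℝ) := by exact_mod_cast hc
    linarith
  induction k with
  | zero => exact ⟨1, fun F => by simp⟩
  | succ k ih =>
    obtain ⟨C, hC⟩ := ih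
    refine ⟨insert 1 A * C, fun F => ?_⟩
    rw [mul_assoc]
    calc (1 + δ) ^ (k + 1) * F.card = (1 + δ) * ((1 + δ) ^ k * F.card) := by ring
      _ ≤ (1 + δ) * ((C * F).card : ℝ) := mul_le_mul_of_nonneg_left (hC F) (by linarith)
      _ ≤ _ := step (C * F)

theorem finitelyAdditive_biUnion {α ι : Type*} {μ : Set α → ℝ}
    (hadd : ∀ A B, Disjoint A B → μ (A ∪ B) = μ A + μ B) (C : Finset ι) (D : ι → Set α)
    (hD : Pairwise fun i j => Disjoint (D i) (D j)) :
    μ (⋃ c ∈ C, D c) = ∑ c ∈ C, μ (D c) := by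
  classical
  induction C using Finset.induction_on with
  | empty =>
    have := hadd ∅ ∅ (by simp)
    simp only [Set.union_self] at this
    simp only [Finset.notMem_empty, Set.iUnion_of_empty, Set.iUnion_empty, Finset.sum_empty]
    linarith
  | insert a s ha ih =>
    rw [Finset.sum_insert ha, ← ih, ← hadd, Finset.set_biUnion_insert]
    simp only [Set.disjoint_iUnion_right]
    intro i hi
    exact hD (fun h => ha (h ▸ hi))

/-- A map that moves points by left translations from a finite set preserves an invariant
finitely additive measure of the whole group. -/
theorem invariant_range_eq_univ {Γ : Type*} [Group Γ] {μ : Set Γ → ℝ}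
    (hadd : ∀ A B, Disjoint A B → μ (A ∪ B) = μ A + μ B)
    (hinv : ∀ (g : Γ) (A : Set Γ), μ ((fun x => g * x) '' A) = μ A)
    (C : Finset Γ) {φ : Γ → Γ} (hφ : Function.Injective φ) (hC : ∀ x, φ x * x⁻¹ ∈ C) :
    μ (Set.range φ) = μ Set.univ := by
  -- On `D c` the map `φ` is left translation by c, and the finitely many `D c` with c in `C`
  -- partition the group.
  set D : Γ → Set Γ := fun c => {x | φ x * x⁻¹ = c} with hDdef
  have hD : Pairwise fun i j => Disjoint (D i) (D j) := by
    intro i j hij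
    rw [Set.disjoint_left]
    intro x hx hx'
    exact hij (hx.symm.trans hx')
  have him : ∀ c, (fun x => c * x) '' D c = φ '' D c := by
    intro c
    refine Set.image_congr fun x hx => ?_
    have : φ x * x⁻¹ = c := hx
    simp [← this]
  have hD' : Pairwise fun i j => Disjoint (φ '' D i) (φ '' D j) := fun i j hij =>
    (Set.disjoint_image_iff hφ).2 (hD hij)
  have hu : (⋃ c ∈ C, D c) = Set.univ := by
    ext x
    simp [hDdef, hC x]
  have hr : (⋃ c ∈ C, φ '' D c) = Set.range φ := by
    rw [← Set.image_iUnion₂, hu, Set.image_univ]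
  rw [← hr, ← hu, finitelyAdditive_biUnion hadd C _ hD, finitelyAdditive_biUnion hadd C _ hD']
  exact Finset.sum_congr rfl fun c _ => by rw [← him, hinv]

/-- **Følner's theorem**: an amenable group has Følner sets. -/
theorem IsAmenable.exists_folner {Γ : Type*} [Group Γ] [DecidableEq Γ] (hΓ : IsAmenable Γ)
    (A : Finset Γ) {δ : ℝ} (hδ : 0 < δ) :
    ∃ F : Finset Γ, F.Nonempty ∧
      ∀ a ∈ A, ((F.filter (fun x => a * x ∉ F)).card : ℝ) ≤ δ * F.card := by
  classical
  by_contra! hcon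
  obtain ⟨k, hk⟩ := pow_unbounded_of_one_lt (2 : ℝ) (show 1 < 1 + δ by linarith)
  obtain ⟨C, hC⟩ := exists_pow_mul_card_le_card_mul hδ.le hcon k
  -- Expansion by 2 is Hall's condition for matching two copies of Γ injectively into Γ, each x
  -- going into `C` x. The images are disjoint and both have measure 1, which is paradoxical.
  have hall : ∀ s : Finset (Γ × Bool),
      s.card ≤ (s.biUnion fun p => C.image (· * p.1)).card := by
    intro s
    have h1 : s.card ≤ (s.image Prod.fst).card * 2 := by
      have : s ⊆ (s.image Prod.fst) ×ˢ (Finset.univ : Finset Bool) := fun p hp =>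
        Finset.mem_product.2 ⟨Finset.mem_image_of_mem _ hp, Finset.mem_univ _⟩
      simpa [Finset.card_product] using Finset.card_le_card this
    have h2 : ((s.image Prod.fst).card : ℝ) * 2 ≤
        ((s.biUnion fun p => C.image (· * p.1)).card : ℝ) := by
      refine le_trans ?_ ((hC (s.image Prod.fst)).trans ?_)
      · rw [mul_comm]
        exact mul_le_mul_of_nonneg_right hk.le (Nat.cast_nonneg _)
      · refine Nat.cast_le.2 (Finset.card_le_card ?_)
        open scoped Pointwise in
        intro z hz
        obtain ⟨c, hc, x, hx, rfl⟩ := Finset.mem_mul.1 hz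
        obtain ⟨p, hp, rfl⟩ := Finset.mem_image.1 hx
        exact Finset.mem_biUnion.2 ⟨p, hp, Finset.mem_image.2 ⟨c, hc, rfl⟩⟩
    exact h1.trans (by exact_mod_cast h2)
  obtain ⟨f, hf, hft⟩ := (Finset.all_card_le_biUnion_card_iff_exists_injective _).1 hall
  obtain ⟨μ, hnn, huniv, hadd, hinv⟩ := hΓ
  have hr : ∀ b, μ (Set.range fun x => f (x, b)) = 1 := by
    intro b
    rw [← huniv]
    refine invariant_range_eq_univ hadd hinv C (fun x y hxy => ?_) fun x => ?_
    · exact congrArg Prod.fst (hf hxy)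
    · obtain ⟨c, hc, hcx⟩ := Finset.mem_image.1 (hft (x, b))
      simp only at hcx
      simpa [← hcx] using hc
  have hdis : Disjoint (Set.range fun x => f (x, true)) (Set.range fun x => f (x, false)) := by
    rw [Set.disjoint_left]
    rintro _ ⟨x, rfl⟩ ⟨y, hy⟩
    simpa using congrArg Prod.snd (hf hy)
  have h2 := hadd _ _ hdis
  have h3 := hadd _ _ (disjoint_compl_right
    (a := (Set.range fun x => f (x, true)) ∪ (Set.range fun x => f (x, false))))
  rw [Set.union_compl_self, huniv, h2, hr, hr] at h3
  linarith [hnn ((Set.range fun x => f (x, true)) ∪ (Set.range fun x => f (x, false)))ᶜ]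

/-! ### Counting in products, and Følner sets for wreath products -/

theorem card_filter_piFinset_le {ι : Type*} [Fintype ι] [DecidableEq ι] {α : ι → Type*}
    [∀ i, DecidableEq (α i)] (F : ∀ i, Finset (α i)) (j : ι) (p : α j → Prop) [DecidablePred p]
    {δ : ℝ} (h : (((F j).filter p).card : ℝ) ≤ δ * (F j).card) :
    (((Fintype.piFinset F).filter fun w => p (w j)).card : ℝ) ≤
      δ * (Fintype.piFinset F).card := by
  have hsub : ((Fintype.piFinset F).filter fun w => p (w j)) ⊆
      Fintype.piFinset (Function.update F j ((F j).filter p)) := by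
    intro w hw
    simp only [Finset.mem_filter, Fintype.mem_piFinset] at hw ⊢
    intro i
    by_cases hi : i = j
    · subst hi
      simpa using ⟨hw.1 i, hw.2⟩
    · simpa [hi] using hw.1 i
  have hc : (((Fintype.piFinset F).filter fun w => p (w j)).card : ℝ) ≤
      ((Fintype.piFinset (Function.update F j ((F j).filter p))).card : ℝ) := by
    exact_mod_cast Finset.card_le_card hsub
  refine hc.trans ?_
  have e : (fun i => (Function.update F j ((F j).filter p) i).card) =
      Function.update (fun i => (F i).card) j ((F j).filter p).card := by
    ext i
    by_cases hi : i = j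
    · subst hi; simp
    · simp [hi]
  rw [Fintype.card_piFinset, Fintype.card_piFinset, e,
    Finset.prod_update_of_mem (Finset.mem_univ j),
    ← Finset.mul_prod_erase Finset.univ (fun i => (F i).card) (Finset.mem_univ j),
    Finset.sdiff_singleton_eq_erase]
  push_cast
  rw [← mul_assoc]
  exact mul_le_mul_of_nonneg_right h (by positivity)

theorem card_filter_exists_le {α ι : Type*} [Fintype ι] (F : Finset α) (p : ι → α → Prop)
    [∀ i, DecidablePred (p i)] [DecidablePred fun x => ∃ i, p i x] {δ : ℝ}
    (h : ∀ i, ((F.filter (p i)).card : ℝ) ≤ δ * F.card) :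
    ((F.filter fun x => ∃ i, p i x).card : ℝ) ≤ (Fintype.card ι * δ) * F.card := by
  classical
  have hsub : (F.filter fun x => ∃ i, p i x) ⊆ Finset.univ.biUnion fun i => F.filter (p i) := by
    intro x hx
    obtain ⟨hx, i, hi⟩ := Finset.mem_filter.1 hx
    exact Finset.mem_biUnion.2 ⟨i, Finset.mem_univ _, Finset.mem_filter.2 ⟨hx, hi⟩⟩
  have h1 := (Finset.card_le_card hsub).trans Finset.card_biUnion_le
  have h2 : ((F.filter fun x => ∃ i, p i x).card : ℝ) ≤ ∑ i, ((F.filter (p i)).card : ℝ) := by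
    exact_mod_cast h1
  refine h2.trans ((Finset.sum_le_sum fun i _ => h i).trans ?_)
  simp [mul_assoc]

/-- If a group `G` maps to the wreath product of a group `Γ` having Følner sets with a finite
symmetric group, by a cocycle `(sg, ix)`, then there are Følner sets of functions on `G`, under
translation, that separate the points that are separated by the cocycle. -/
theorem exists_folner_of_cocycle {G Γ ι : Type*} [Group G] [Group Γ] [Finite ι]
    [DecidableEq Γ] [DecidableEq (G → Γ × ι)]
    (hΓ : ∀ (A : Finset Γ) (δ : ℝ), 0 < δ → ∃ F : Finset Γ, F.Nonempty ∧
      ∀ a ∈ A, ((F.filter fun x => a * x ∉ F).card : ℝ) ≤ δ * F.card)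
    (sg : G → Γ) (ix : G → ι) (rep : ι → G) (hrep : ∀ i, ix (rep i) = i)
    (hix : ∀ x g, ix (x * g) = ix (rep (ix x) * g))
    (hsg : ∀ x g, sg (x * g) = sg x * sg (rep (ix x) * g))
    (A : Finset G) {δ : ℝ} (hδ : 0 < δ) :
    ∃ F : Finset (G → Γ × ι), F.Nonempty ∧
      (∀ u ∈ F, ∀ x y, u x = u y → sg x = sg y ∧ ix x = ix y) ∧
      ∀ g ∈ A, ((F.filter fun u => (fun x => u (x * g)) ∉ F).card : ℝ) ≤ δ * F.card := by
  classical
  have := Fintype.ofFinite ι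
  -- The bound leaves room for a union over the `ι` coordinates; the added 1 keeps the denominator
  -- positive.
  obtain ⟨F₀, hF₀, hF₀'⟩ := hΓ
    (A.biUnion fun g => Finset.univ.image fun i => sg (rep i * g)) (δ / (Fintype.card ι + 1))
    (by positivity)
  -- Injective self-maps of the finite set `ι` are its permutations. This factor is exactly
  -- invariant, so only the Γ-coordinates can leave `Z`.
  set Z : Finset ((ι → Γ) × (ι → ι)) :=
    (Fintype.piFinset fun _ : ι => F₀) ×ˢ (Finset.univ.filter Function.Injective) with hZ
  set Φ : (ι → Γ) × (ι → ι) → G → Γ × ι := fun z x => (sg x * z.1 (ix x), z.2 (ix x)) with hΦ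
  have hΦinj : Function.Injective Φ := by
    rintro ⟨f, p⟩ ⟨f', p'⟩ h
    have h' : ∀ i, f i = f' i ∧ p i = p' i := by
      intro i
      have := congrFun h (rep i)
      simpa [hΦ, hrep] using this
    exact Prod.ext (funext fun i => (h' i).1) (funext fun i => (h' i).2)
  -- By the cocycle identities, translation by g becomes the action of a wreath product element on
  -- the parameters.
  have hshift : ∀ (z : (ι → Γ) × (ι → ι)) (g : G), (fun x => Φ z (x * g)) =
      Φ (fun i => sg (rep i * g) * z.1 (ix (rep i * g)), fun i => z.2 (ix (rep i * g))) := by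
    intro z g
    ext x
    · simp only [hΦ]
      rw [hsg, hix, mul_assoc]
    · simp only [hΦ]
      rw [hix]
  have hπ : ∀ g, Function.Injective fun i => ix (rep i * g) := by
    intro g
    have : Function.LeftInverse (fun i => ix (rep i * g⁻¹)) (fun i => ix (rep i * g)) := by
      intro i
      simp only
      rw [← hix, mul_inv_cancel_right, hrep]
    exact this.injective
  refine ⟨Z.image Φ, ?_, ?_, ?_⟩
  · refine Finset.Nonempty.image ?_ _
    refine Finset.Nonempty.product ?_ ⟨id, by simp [Function.injective_id]⟩
    exact Fintype.piFinset_nonempty.2 fun _ => hF₀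
  · intro u hu x y hxy
    obtain ⟨z, hz, rfl⟩ := Finset.mem_image.1 hu
    have hp : Function.Injective z.2 := by
      simpa using (Finset.mem_product.1 hz).2
    have h2 : ix x = ix y := hp (congrArg Prod.snd hxy)
    have h1 := congrArg Prod.fst hxy
    simp only [hΦ, h2] at h1
    exact ⟨mul_right_cancel h1, h2⟩
  · intro g hg
    have hbad : ∀ i, ((Z.filter fun z => sg (rep i * g) * z.1 (ix (rep i * g)) ∉ F₀).card : ℝ) ≤
        δ / (Fintype.card ι + 1) * Z.card := by
      intro i
      have e : (Z.filter fun z => sg (rep i * g) * z.1 (ix (rep i * g)) ∉ F₀) =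
          ((Fintype.piFinset fun _ : ι => F₀).filter
            fun f => sg (rep i * g) * f (ix (rep i * g)) ∉ F₀) ×ˢ
              (Finset.univ.filter Function.Injective) := by
        ext z
        simp only [hZ, Finset.mem_filter, Finset.mem_product]
        tauto
      rw [e, hZ, Finset.card_product, Finset.card_product]
      push_cast
      rw [← mul_assoc]
      refine mul_le_mul_of_nonneg_right ?_ (Nat.cast_nonneg _)
      refine card_filter_piFinset_le (fun _ : ι => F₀) (ix (rep i * g))
        (fun a => sg (rep i * g) * a ∉ F₀) (hF₀' (sg (rep i * g)) ?_)
      exact Finset.mem_biUnion.2 ⟨g, hg, Finset.mem_image_of_mem _ (Finset.mem_univ _)⟩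
    have hsub : ((Z.image Φ).filter fun u => (fun x => u (x * g)) ∉ Z.image Φ) ⊆
        (Z.filter fun z => ∃ i, sg (rep i * g) * z.1 (ix (rep i * g)) ∉ F₀).image Φ := by
      intro u hu
      obtain ⟨hu, hu'⟩ := Finset.mem_filter.1 hu
      obtain ⟨z, hz, rfl⟩ := Finset.mem_image.1 hu
      refine Finset.mem_image_of_mem _ (Finset.mem_filter.2 ⟨hz, ?_⟩)
      by_contra! hall
      apply hu'
      rw [hshift]
      refine Finset.mem_image_of_mem _ (Finset.mem_product.2 ⟨?_, ?_⟩)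
      · exact Fintype.mem_piFinset.2 hall
      · have hp : Function.Injective z.2 := by
          simpa using (Finset.mem_product.1 hz).2
        exact Finset.mem_filter.2 ⟨Finset.mem_univ _, hp.comp (hπ g)⟩
    have hc : (((Z.image Φ).filter fun u => (fun x => u (x * g)) ∉ Z.image Φ).card : ℝ) ≤
        ((Z.filter fun z => ∃ i, sg (rep i * g) * z.1 (ix (rep i * g)) ∉ F₀).card : ℝ) := by
      exact_mod_cast (Finset.card_le_card hsub).trans Finset.card_image_le
    rw [Finset.card_image_of_injective _ hΦinj]
    refine hc.trans ((card_filter_exists_le Z _ hbad).trans ?_)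
    refine mul_le_mul_of_nonneg_right ?_ (Nat.cast_nonneg _)
    rw [mul_div_assoc', div_le_iff₀ (by positivity)]
    nlinarith

/-! ### Green's relations, units and maximal subgroups -/

section Green

variable {M : Type u} [Monoid M]

theorem GreenL.refl (x : M) : GreenL x x := rfl

theorem greenL_of_classL_eq {x y : M} (h : classL x = classL y) : GreenL x y := by
  have : y ∈ classL y := GreenL.refl y
  rw [← h] at this
  exact this

theorem GreenL.classL_eq {x y : M} (h : GreenL x y) : classL x = classL y := by
  ext z
  exact ⟨fun hz => h.symm.trans hz, fun hz => h.trans hz⟩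

theorem GreenL.mul_right {x y : M} (h : GreenL x y) (z : M) : GreenL (x * z) (y * z) := by
  have key : ∀ w : M, Set.range (fun m : M => m * (w * z)) =
      (fun v => v * z) '' Set.range (fun m : M => m * w) := by
    intro w
    rw [← Set.range_comp]
    exact congrArg Set.range (funext fun m => (mul_assoc _ _ _).symm)
  unfold GreenL at h ⊢
  rw [key, key, h]

theorem GreenL.exists_mul_eq {x y : M} (h : GreenL x y) : ∃ m, m * x = y := by
  have : y ∈ Set.range (fun m : M => m * y) := ⟨1, one_mul y⟩
  rw [← h] at this
  exact this

theorem greenR_mul_of_mul_eq_one (n : M) {x y : M} (h : x * y = 1) : GreenR n (n * x) := by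
  ext z
  constructor
  · rintro ⟨m, rfl⟩
    exact ⟨y * m, by simp only [mul_assoc, ← mul_assoc x y, h, one_mul]⟩
  · rintro ⟨m, rfl⟩
    exact ⟨x * m, by simp only [mul_assoc]⟩

/-- All powers of x are `ℛ`-related to 1, so two of them are `ℒ`-related; cancelling the smaller
power on the right by a power of y leaves a left inverse of x. -/
theorem mul_eq_one_comm_of_finite (hfin : (classL '' classD (1 : M)).Finite) {x y : M}
    (h : x * y = 1) : y * x = 1 := by
  have hpow : ∀ k, x ^ k * y ^ k = 1 := by
    intro k
    induction k with
    | zero => simp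
    | succ k ih => rw [pow_succ, pow_succ', mul_assoc, ← mul_assoc x y, h, one_mul, ih]
  have hmem : ∀ k : ℕ, classL (x ^ k) ∈ classL '' classD (1 : M) := fun k =>
    ⟨x ^ k, ⟨1, GreenL.refl 1, by simpa using greenR_mul_of_mul_eq_one 1 (hpow k)⟩, rfl⟩
  obtain ⟨i, j, hij, he⟩ : ∃ i j : ℕ, i < j ∧ classL (x ^ i) = classL (x ^ j) := by
    have := hfin.to_subtype
    obtain ⟨i, j, hne, he⟩ := Finite.exists_ne_map_eq_of_infinite
      fun k : ℕ => (⟨classL (x ^ k), hmem k⟩ : classL '' classD (1 : M))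
    have he' := congrArg Subtype.val he
    rcases lt_or_gt_of_ne hne with h | h
    · exact ⟨i, j, h, he'⟩
    · exact ⟨j, i, h, he'.symm⟩
  obtain ⟨m, hm⟩ := (greenL_of_classL_eq he.symm).exists_mul_eq
  obtain ⟨k, rfl⟩ := Nat.exists_eq_add_of_lt hij
  have hl : m * x ^ k * x = 1 := by
    have h1 := congrArg (· * y ^ i) hm
    simp only [hpow] at h1
    rw [show i + k + 1 = (k + 1) + i by omega, pow_add, ← mul_assoc, mul_assoc (m * _), hpow,
      mul_one, pow_succ, ← mul_assoc] at h1
    exact h1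
  rw [← left_inv_eq_right_inv hl h]
  exact hl

theorem isUnit_of_mul_eq_one_of_finite (hfin : (classL '' classD (1 : M)).Finite) {x y : M}
    (h : x * y = 1) : IsUnit x :=
  ⟨⟨x, y, h, mul_eq_one_comm_of_finite hfin h⟩, rfl⟩

theorem isUnit_mul_iff_of_finite (hfin : (classL '' classD (1 : M)).Finite) {x y : M} :
    IsUnit (x * y) ↔ IsUnit x ∧ IsUnit y := by
  refine ⟨fun ⟨u, hu⟩ => ?_, fun h => h.1.mul h.2⟩
  have h1 : x * (y * ↑u⁻¹) = 1 := by rw [← mul_assoc, ← hu, Units.mul_inv]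
  have h2 : ↑u⁻¹ * x * y = 1 := by rw [mul_assoc, ← hu, Units.inv_mul]
  refine ⟨isUnit_of_mul_eq_one_of_finite hfin h1, ?_⟩
  exact ⟨⟨y, ↑u⁻¹ * x, mul_eq_one_comm_of_finite hfin h2, h2⟩, rfl⟩

/-- The maximal subgroup around an idempotent. -/
def maximalSubgroup (e : M) : Subsemigroup M where
  carrier := {x | e * x = x ∧ x * e = x ∧ ∃ y, e * y = y ∧ y * e = y ∧ y * x = e ∧ x * y = e}
  mul_mem' := by
    rintro a b ⟨ha, ha', c, hc, hc', hca, hac⟩ ⟨hb, hb', d, hd, hd', hdb, hbd⟩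
    refine ⟨by rw [← mul_assoc, ha], by rw [mul_assoc, hb'], d * c, by rw [← mul_assoc, hd],
      by rw [mul_assoc, hc'], ?_, ?_⟩
    · rw [mul_assoc, ← mul_assoc c, hca, hb, hdb]
    · rw [mul_assoc, ← mul_assoc b, hbd, hc, hac]

theorem isSubgroupOf_maximalSubgroup {e : M} (he : e * e = e) :
    IsSubgroupOf (maximalSubgroup e) := by
  refine ⟨e, ⟨he, he, e, he, he, he, he⟩, fun x hx => ⟨hx.1, hx.2.1⟩, ?_⟩
  rintro x ⟨hx, hx', y, hy, hy', hyx, hxy⟩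
  exact ⟨y, ⟨hy, hy', x, hx, hx', hxy, hyx⟩, hyx, hxy⟩

theorem not_isUnit_of_mem_maximalSubgroup {e x : M} (he : ¬ IsUnit e)
    (hx : x ∈ maximalSubgroup e) : ¬ IsUnit x := by
  intro hu
  have : e * x = 1 * x := by rw [hx.1, one_mul]
  exact he (hu.mul_right_cancel this ▸ isUnit_one)

/-- In the `ℛ`-class of `n`, which contains the idempotent `n * y`, the element `n * u` arises from
an `ℒ`-equivalent element `n * v` by left multiplication with an element of the maximal
subgroup around `n * y`. -/
theorem mem_maximalSubgroup_of_greenL {n y : M} (hy : n * y * n = n) (u v : Mˣ)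
    (h : GreenL (n * u) (n * v)) :
    n * u * ↑v⁻¹ * y * (n * y) ∈ maximalSubgroup (n * y) ∧
      n * u * ↑v⁻¹ * y * (n * y) * (n * v) = n * u := by
  -- Writing nu = m(nv) reduces this to nyn = n.
  have key : ∀ u v : Mˣ, GreenL (n * u) (n * v) → n * u * ↑v⁻¹ * y * (n * v) = n * u := by
    intro u v h
    obtain ⟨m, hm⟩ := GreenL.exists_mul_eq h.symm
    calc n * u * ↑v⁻¹ * y * (n * v) = m * (n * v) * ↑v⁻¹ * y * (n * v) := by rw [hm]
      _ = m * (n * (v * ↑v⁻¹) * y * n * v) := by simp only [mul_assoc]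
      _ = n * u := by rw [Units.mul_inv, mul_one, hy, hm]
  have hl : ∀ z, n * y * (n * z) = n * z := fun z => by rw [← mul_assoc, hy]
  have hinv : ∀ u v : Mˣ, GreenL (n * u) (n * v) →
      n * u * ↑v⁻¹ * y * (n * y) * (n * v * ↑u⁻¹ * y * (n * y)) = n * y := by
    intro u v h
    calc n * u * ↑v⁻¹ * y * (n * y) * (n * v * ↑u⁻¹ * y * (n * y))
        = n * u * ↑v⁻¹ * y * ((n * y * n) * v) * ↑u⁻¹ * y * (n * y) := by simp only [mul_assoc]
      _ = n * (u * ↑u⁻¹) * y * (n * y) := by rw [hy, key u v h]; simp only [mul_assoc]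
      _ = n * y := by rw [Units.mul_inv, mul_one, hl]
  have hle : ∀ u v : Mˣ, n * y * (n * u * ↑v⁻¹ * y * (n * y)) = n * u * ↑v⁻¹ * y * (n * y) := by
    intro u v
    simp only [mul_assoc, hl]
  have hri : ∀ u v : Mˣ, n * u * ↑v⁻¹ * y * (n * y) * (n * y) = n * u * ↑v⁻¹ * y * (n * y) := by
    intro u v
    rw [mul_assoc _ (n * y), hl]
  refine ⟨⟨hle u v, hri u v, n * v * ↑u⁻¹ * y * (n * y), hle v u, hri v u, hinv v u h.symm,
    hinv u v h⟩, ?_⟩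
  rw [mul_assoc _ (n * y), hl, key u v h]

/-- The cocycle records the `ℒ`-class of nu and the element of the maximal subgroup carrying the
chosen representative of that class to nu. Together they determine nu, so separating their values
separates the orbit. -/
theorem exists_folner_of_not_isUnit (hreg : IsRegularMonoid M)
    (hsub : ∀ (S : Subsemigroup M) (hS : IsSubgroupOf S),
      (∀ x ∈ S, ¬ IsUnit x) → @IsAmenable S hS.group)
    (hfin : ∀ x : M, (classL '' classD x).Finite) {n : M} (hn : ¬ IsUnit n) :
    ∃ T : Type u, ∀ [DecidableEq (Mˣ → T)], ∀ (A : Finset Mˣ) (δ : ℝ), 0 < δ →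
      ∃ F : Finset (Mˣ → T), F.Nonempty ∧
        (∀ w ∈ F, ∀ u v : Mˣ, w u = w v → n * u = n * v) ∧
        ∀ g ∈ A, ((F.filter fun w => (fun u => w (u * g)) ∉ F).card : ℝ) ≤ δ * F.card := by
  classical
  obtain ⟨y, hy⟩ := hreg n
  have he : n * y * (n * y) = n * y := by rw [← mul_assoc, hy]
  have hne : ¬ IsUnit (n * y) := fun h => hn ((isUnit_mul_iff_of_finite (hfin 1)).1 h).1
  have hS := isSubgroupOf_maximalSubgroup he
  have ham := hsub _ hS fun x hx => not_isUnit_of_mem_maximalSubgroup hne hx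
  let _ : Group (maximalSubgroup (n * y)) := hS.group
  let ι := Set.range fun u : Mˣ => classL (n * (u : M))
  have hι : Finite ι := by
    refine ((hfin n).subset ?_).to_subtype
    rintro _ ⟨u, rfl⟩
    exact ⟨n * u, ⟨n, GreenL.refl n, greenR_mul_of_mul_eq_one n u.mul_inv⟩, rfl⟩
  let ix : Mˣ → ι := fun u => ⟨classL (n * (u : M)), u, rfl⟩
  let rep : ι → Mˣ := fun i => i.2.choose
  have hrep : ∀ i, ix (rep i) = i := fun i => Subtype.ext i.2.choose_spec
  have hL : ∀ {u v : Mˣ}, ix u = ix v → GreenL (n * (u : M)) (n * v) := fun h =>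
    greenL_of_classL_eq (congrArg Subtype.val h)
  have hrL : ∀ u : Mˣ, GreenL (n * (u : M)) (n * rep (ix u)) := fun u => hL (hrep (ix u)).symm
  let sg : Mˣ → maximalSubgroup (n * y) := fun u =>
    ⟨_, (mem_maximalSubgroup_of_greenL hy u (rep (ix u)) (hrL u)).1⟩
  have hix : ∀ u g, ix (u * g) = ix (rep (ix u) * g) := by
    intro u g
    apply Subtype.ext
    change classL (n * ↑(u * g)) = classL (n * ↑(rep (ix u) * g))
    rw [Units.val_mul, Units.val_mul, ← mul_assoc, ← mul_assoc]
    exact ((hrL u).mul_right g).classL_eq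
  have hsg : ∀ u g, sg (u * g) = sg u * sg (rep (ix u) * g) := by
    intro u g
    apply Subtype.ext
    change n * ↑(u * g) * ↑(rep (ix (u * g)))⁻¹ * y * (n * y) =
      n * u * ↑(rep (ix u))⁻¹ * y * (n * y) *
        (n * ↑(rep (ix u) * g) * ↑(rep (ix (rep (ix u) * g)))⁻¹ * y * (n * y))
    have h1 := (mem_maximalSubgroup_of_greenL hy u (rep (ix u)) (hrL u)).2
    -- Both sides now use the same representative, and the identity follows from `sg u` carrying n
    -- `rep (ix u)` to nu.
    rw [← hix]
    generalize rep (ix (u * g)) = q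
    rw [Units.val_mul, Units.val_mul]
    simp only [← mul_assoc] at h1 ⊢
    rw [h1]
  refine ⟨maximalSubgroup (n * y) × ι, ?_⟩
  intro _ A δ hδ
  obtain ⟨F, hF, hF', hF''⟩ := exists_folner_of_cocycle
    (fun A δ hδ => ham.exists_folner A hδ) sg ix rep hrep hix hsg A hδ
  refine ⟨F, hF, fun w hw u v huv => ?_, hF''⟩
  obtain ⟨h1, h2⟩ := hF' w hw u v huv
  have hu := (mem_maximalSubgroup_of_greenL hy u (rep (ix u)) (hrL u)).2
  have hv := (mem_maximalSubgroup_of_greenL hy v (rep (ix v)) (hrL v)).2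
  have h1' := congrArg Subtype.val h1
  simp only [sg] at h1'
  rw [← hu, ← hv, h1', h2]

end Green

/-! ### Soficity by counting exceptional points -/

theorem proportion_le_of_card_le {X : Type} [Fintype X] [Nonempty X] {p : X → Prop}
    [DecidablePred p] {ε : ℝ}
    (h : ((Finset.univ.filter p).card : ℝ) ≤ ε * Fintype.card X) : proportion X p ≤ ε := by
  have e : {x | p x}.ncard = (Finset.univ.filter p).card := by
    rw [← Set.ncard_coe_finset]; simp
  unfold proportion
  rw [Nat.card_eq_fintype_card, e, div_le_iff₀ (by exact_mod_cast Fintype.card_pos)]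
  exact h

theorem card_le_of_proportion_le {X : Type} [Fintype X] [Nonempty X] {p : X → Prop}
    [DecidablePred p] {ε : ℝ}
    (h : proportion X p ≤ ε) : ((Finset.univ.filter p).card : ℝ) ≤ ε * Fintype.card X := by
  have e : {x | p x}.ncard = (Finset.univ.filter p).card := by
    rw [← Set.ncard_coe_finset]; simp
  unfold proportion at h
  rwa [Nat.card_eq_fintype_card, e, div_le_iff₀ (by exact_mod_cast Fintype.card_pos)] at h

theorem proportion_not {X : Type} [Finite X] [Nonempty X] (p : X → Prop) :
    proportion X (fun x => ¬ p x) = 1 - proportion X p := by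
  have h := Set.ncard_add_ncard_compl {x | p x}
  have hpos : (0 : ℝ) < Nat.card X := by exact_mod_cast Nat.card_pos
  have h' : (({x | p x}.ncard : ℝ)) + ({x | ¬ p x}.ncard : ℝ) = Nat.card X := by
    exact_mod_cast h
  unfold proportion
  rw [eq_sub_iff_add_eq, ← add_div, div_eq_one_iff_eq hpos.ne']
  linarith

/-- It is enough to bound the numbers of exceptional points, on finite sets in any universe. -/
theorem IsSofic.of_card_le {M : Type*} [Monoid M]
    (h : ∀ (K : Finset M) (ε : ℝ), 0 < ε →
      ∃ (X : Type*) (_ : Fintype X) (_ : DecidableEq X) (_ : Nonempty X) (act : M → X → X),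
        (∀ x, act 1 x = x) ∧
        (∀ g ∈ K, ∀ h ∈ K,
          ((Finset.univ.filter fun x => act g (act h x) ≠ act (g * h) x).card : ℝ) ≤
            ε * Fintype.card X) ∧
        (∀ g ∈ K, ∀ h ∈ K, g ≠ h →
          ((Finset.univ.filter fun x => act g x = act h x).card : ℝ) ≤ ε * Fintype.card X)) :
    IsSofic M := by
  intro K ε hε
  obtain ⟨X, _, _, hX, act, h1, h2, h3⟩ := h K ε hε
  let φ := Fintype.equivFin X
  have hne : Nonempty (Fin (Fintype.card X)) := ⟨φ hX.some⟩
  have hcard : ∀ (p : X → Prop) [DecidablePred p] (q : Fin (Fintype.card X) → Prop)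
      [DecidablePred q], (∀ x, q (φ x) ↔ p x) →
      ((Finset.univ.filter p).card : ℝ) ≤ ε * Fintype.card X →
      ((Finset.univ.filter q).card : ℝ) ≤ ε * Fintype.card (Fin (Fintype.card X)) := by
    intro p _ q _ hpq hp
    rw [Fintype.card_fin]
    refine le_trans (le_of_eq ?_) hp
    congr 1
    symm
    refine Finset.card_bij (fun x _ => φ x) ?_ (fun _ _ _ _ h => φ.injective h) ?_
    · intro x hx
      simpa [hpq] using hx
    · intro z hz
      refine ⟨φ.symm z, ?_, by simp⟩
      simpa [← hpq] using hz
  refine ⟨Fin (Fintype.card X), inferInstance, hne, fun m z => φ (act m (φ.symm z)),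
    ⟨fun z => by simp [h1], fun g hg h hh => ?_, fun g hg h hh hgh => ?_⟩⟩
  · have hb := proportion_le_of_card_le (hcard _
      (fun z => ¬ φ (act g (φ.symm (φ (act h (φ.symm z))))) = φ (act (g * h) (φ.symm z)))
      (fun x => by simp) (h2 g hg h hh))
    rw [proportion_not] at hb
    linarith
  · exact proportion_le_of_card_le (hcard _ _ (fun x => by simp) (h3 g hg h hh hgh))

/-- A form of soficity in terms of the numbers of exceptional points. -/
theorem IsSofic.exists_card_le {G : Type*} [Monoid G] (hG : IsSofic G) (K : Finset G) {ε : ℝ}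
    (hε : 0 < ε) :
    ∃ (X : Type) (_ : Fintype X) (_ : DecidableEq X) (_ : Nonempty X) (act : G → X → X),
      (∀ x, act 1 x = x) ∧
      (∀ g ∈ K, ∀ h ∈ K,
        ((Finset.univ.filter fun x => act g (act h x) ≠ act (g * h) x).card : ℝ) ≤
          ε * Fintype.card X) ∧
      (∀ g ∈ K, ∀ h ∈ K, g ≠ h →
        ((Finset.univ.filter fun x => act g x = act h x).card : ℝ) ≤ ε * Fintype.card X) := by
  classical
  obtain ⟨X, _, hX, act, ⟨h1, h2, h3⟩⟩ := hG K ε hε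
  have := Fintype.ofFinite X
  refine ⟨X, inferInstance, inferInstance, hX, act, h1, fun g hg h hh => ?_,
    fun g hg h hh hgh => card_le_of_proportion_le (h3 g hg h hh hgh)⟩
  refine card_le_of_proportion_le ?_
  have := proportion_not (fun x => act g (act h x) = act (g * h) x)
  have h2' := h2 g hg h hh
  simp only [ne_eq]
  linarith

/-! ### Approximately equivariant maps to the group of units -/

/-- Finite approximate actions of the group of units, with maps to that group that are
approximately equivariant up to left multiplication with elements of `L`. -/
theorem exists_approx_equivariant {M : Type u} [Monoid M] (L : Finset M)
    (hL : ∀ n ∈ L, ∃ T : Type u, ∀ [DecidableEq (Mˣ → T)], ∀ (A : Finset Mˣ) (δ : ℝ), 0 < δ →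
      ∃ F : Finset (Mˣ → T), F.Nonempty ∧
        (∀ w ∈ F, ∀ u v : Mˣ, w u = w v → n * u = n * v) ∧
        ∀ g ∈ A, ((F.filter fun w => (fun u => w (u * g)) ∉ F).card : ℝ) ≤ δ * F.card)
    (A : Finset Mˣ) {δ : ℝ} (hδ : 0 < δ) :
    ∃ (Z : Type u) (_ : Fintype Z) (_ : Nonempty Z) (act : Mˣ → Z → Z) (a : Z → Mˣ) (B : Finset Z),
      (B.card : ℝ) ≤ δ * Fintype.card Z ∧ (∀ z, act 1 z = z) ∧
      ∀ z ∉ B, ∀ g ∈ A, (∀ h ∈ A, act h (act g z) = act (h * g) z) ∧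
        ∀ n ∈ L, n * a (act g z) = n * g * a z := by
  classical
  choose! T hT using hL
  -- Products are included so that a good point stays in the Følner set under g and under h * g; δ'
  -- allows a union bound over `A'` × `L`.
  set A' : Finset Mˣ := A ∪ (A ×ˢ A).image fun p => p.1 * p.2 with hA'
  set δ' : ℝ := δ / ((A'.card * L.card) + 1) with hδ'
  choose F hFne hFsep hF using fun n : L => hT n n.2 A' δ' (by positivity)
  let W := ∀ n : L, Mˣ → T n
  let tr : Mˣ → W → W := fun g w n u => w n (u * g)
  have tr_mul : ∀ g h w, tr g (tr h w) = tr (g * h) w := by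
    intro g h w
    funext n u
    simp only [tr, mul_assoc]
  have tr_one : ∀ w, tr 1 w = w := by
    intro w
    funext n u
    simp only [tr, mul_one]
  let _ : MulAction Mˣ W :=
    { smul := tr, one_smul := tr_one, mul_smul := fun g h w => (tr_mul g h w).symm }
  have hrep : ∀ w : W, ∃ g : Mˣ, g • (Quotient.out (Quotient.mk (MulAction.orbitRel Mˣ W) w)) = w :=
    fun w => (MulAction.orbitRel Mˣ W).symm (Quotient.mk_out (s := MulAction.orbitRel Mˣ W) w)
  -- `a w` moves the chosen representative c of the orbit of w to w; c need not lie in the Følner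
  -- set.
  choose a ha using hrep
  set E : Finset W := Fintype.piFinset F with hE
  have hEne : E.Nonempty := Fintype.piFinset_nonempty.2 hFne
  have equi : ∀ (w : W) (g : Mˣ), w ∈ E → ∀ n ∈ L, n * (a (g • w) : M) = n * g * a w := by
    intro w g hw n hn
    set c : W := Quotient.out (Quotient.mk (MulAction.orbitRel Mˣ W) w) with hc
    have hc1 : a w • c = w := ha w
    have hc2 : a (g • w) • c = g • w := by
      have : Quotient.mk (MulAction.orbitRel Mˣ W) (g • w) =
          Quotient.mk (MulAction.orbitRel Mˣ W) w := Quotient.sound ⟨g, rfl⟩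
      rw [hc, ← this]
      exact ha _
    have h1 : c ⟨n, hn⟩ (a (g • w)) = w ⟨n, hn⟩ g := by
      have := congrFun (congrFun hc2 ⟨n, hn⟩) 1
      change c ⟨n, hn⟩ (1 * _) = w ⟨n, hn⟩ (1 * g) at this
      simpa using this
    have h2 : c ⟨n, hn⟩ (g * a w) = w ⟨n, hn⟩ g :=
      congrFun (congrFun hc1 ⟨n, hn⟩) g
    have hcw : ∀ u, c ⟨n, hn⟩ u = w ⟨n, hn⟩ (u * (a w)⁻¹) := by
      intro u
      have := congrFun (congrFun hc1 ⟨n, hn⟩) (u * (a w)⁻¹)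
      change c ⟨n, hn⟩ (u * (a w)⁻¹ * a w) = _ at this
      simpa using this
    -- The elements `a (g • w)` and `g * a w` send c to the same point, so c agrees at them.
    -- Separation is known only for w, hence the shift of both arguments by `(a w)⁻¹`.
    have h3 := hFsep ⟨n, hn⟩ (w ⟨n, hn⟩) (Fintype.mem_piFinset.1 hw ⟨n, hn⟩)
      (a (g • w) * (a w)⁻¹) (g * a w * (a w)⁻¹) (by rw [← hcw, ← hcw, h1, h2])
    simp only [Units.val_mul, mul_assoc, Units.mul_inv, mul_one] at h3
    have h4 := congrArg (· * (a w : M)) h3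
    simpa [mul_assoc] using h4
  -- Points that would leave `E` stay fixed; this happens for g in `A'` only on the small set of bad
  -- points.
  let act : Mˣ → E → E := fun g z => if h : g • (z : W) ∈ E then ⟨g • (z : W), h⟩ else z
  have act_val : ∀ g (z : E), g • (z : W) ∈ E → (act g z : W) = g • (z : W) := by
    intro g z h
    simp only [act, dif_pos h]
  let bad : A' × L → W → Prop := fun p w => (fun u => w p.2 (u * p.1)) ∉ F p.2
  have hbad : ∀ p, ((E.filter (bad p)).card : ℝ) ≤ δ' * E.card := fun p =>
    card_filter_piFinset_le F p.2 (fun w => (fun u => w (u * p.1)) ∉ F p.2) (hF p.2 p.1 p.1.2)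
  have hcount := card_filter_exists_le E bad hbad
  have hgood : ∀ w : W, (¬ ∃ p, bad p w) → ∀ g ∈ A', g • w ∈ E := by
    intro w hw g hg
    refine Fintype.mem_piFinset.2 fun n => ?_
    by_contra hcon
    exact hw ⟨(⟨g, hg⟩, n), hcon⟩
  refine ⟨E, inferInstance, hEne.to_subtype, act, fun z => a z,
    Finset.univ.filter fun z : E => ∃ p, bad p z, ?_, ?_, ?_⟩
  · have e : ((Finset.univ.filter fun z : E => ∃ p, bad p z).card : ℝ) ≤
        ((E.filter fun w => ∃ p, bad p w).card : ℝ) := by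
      refine Nat.cast_le.2 (Finset.card_le_card_of_injOn Subtype.val ?_
        Subtype.val_injective.injOn)
      intro z hz
      simp only [Finset.coe_filter, Finset.mem_univ, true_and, Set.mem_ofPred_eq] at hz ⊢
      exact ⟨z.2, hz⟩
    refine e.trans (hcount.trans ?_)
    rw [Fintype.card_coe]
    refine mul_le_mul_of_nonneg_right ?_ (Nat.cast_nonneg _)
    rw [Fintype.card_prod, Fintype.card_coe, Fintype.card_coe, hδ', mul_div_assoc',
      div_le_iff₀ (by positivity)]
    push_cast
    nlinarith
  · intro z
    apply Subtype.ext
    rw [act_val _ _ (by rw [one_smul]; exact z.2), one_smul]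
  · intro z hz g hg
    have hz' := hgood z (by simpa using hz)
    have hg' : g ∈ A' := Finset.mem_union_left _ hg
    have e1 := act_val g z (hz' g hg')
    refine ⟨fun h hh => ?_, fun n hn => ?_⟩
    · have hhg : h * g ∈ A' :=
        Finset.mem_union_right _ (Finset.mem_image.2 ⟨(h, g), Finset.mk_mem_product hh hg, rfl⟩)
      have e2 := act_val (h * g) z (hz' _ hhg)
      apply Subtype.ext
      rw [act_val h (act g z) (by rw [e1, ← mul_smul]; exact hz' _ hhg), e1, e2, mul_smul]
    · beta_reduce
      rw [e1]
      exact equi z g z.2 n hn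

/-! ### Assembling the approximate action of the monoid -/

/-- Exceptional points lie over `B₀`, over `B`, or in `Y`, and each of these contributes at most the
proportion δ. All of `Y` is given up. -/
theorem card_filter_sum_le {X Z Y : Type*} [Fintype X] [Nonempty X] [Fintype Z] [Nonempty Z]
    [Fintype Y] {N : ℕ} {δ : ℝ} (hY : (Fintype.card Y : ℝ) ≤ δ * N)
    (hδ : 0 ≤ δ) (p : (X × Z × Fin N) ⊕ Y → Prop) [DecidablePred p] (B₀ : Finset X)
    (B : Finset Z) (hB₀ : (B₀.card : ℝ) ≤ δ * Fintype.card X)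
    (hB : (B.card : ℝ) ≤ δ * Fintype.card Z)
    (hp : ∀ x z i, x ∉ B₀ → z ∉ B → ¬ p (Sum.inl (x, z, i))) :
    ((Finset.univ.filter p).card : ℝ) ≤ 3 * δ * Fintype.card ((X × Z × Fin N) ⊕ Y) := by
  classical
  have hsub : Finset.univ.filter p ⊆
      ((B₀ ×ˢ (Finset.univ : Finset (Z × Fin N))) ∪
        ((Finset.univ : Finset X) ×ˢ B ×ˢ (Finset.univ : Finset (Fin N)))).disjSum
          (Finset.univ : Finset Y) := by
    intro q hq
    rw [Finset.mem_filter] at hq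
    rcases q with ⟨x, z, i⟩ | y
    · rw [Finset.inl_mem_disjSum]
      by_contra hcon
      simp only [Finset.mem_union, Finset.mem_product, Finset.mem_univ, and_true, true_and,
        not_or] at hcon
      exact hp x z i hcon.1 hcon.2 hq.2
    · simp
  have h1 := Finset.card_le_card hsub
  rw [Finset.card_disjSum] at h1
  have h2 := h1.trans (Nat.add_le_add_right (Finset.card_union_le _ _) _)
  simp only [Finset.card_product, Finset.card_univ, Fintype.card_prod, Fintype.card_fin] at h2
  have h3 : ((Finset.univ.filter p).card : ℝ) ≤ B₀.card * (Fintype.card Z * N) +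
      Fintype.card X * (B.card * N) + Fintype.card Y := by exact_mod_cast h2
  rw [Fintype.card_sum, Fintype.card_prod, Fintype.card_prod, Fintype.card_fin]
  push_cast
  have hX1 : (1 : ℝ) ≤ Fintype.card X := by exact_mod_cast Fintype.card_pos
  have hZ1 : (1 : ℝ) ≤ Fintype.card Z := by exact_mod_cast Fintype.card_pos
  have a1 : (B₀.card : ℝ) * (Fintype.card Z * N) ≤
      δ * Fintype.card X * (Fintype.card Z * N) := mul_le_mul_of_nonneg_right hB₀ (by positivity)
  have a2 : (Fintype.card X : ℝ) * (B.card * N) ≤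
      Fintype.card X * (δ * Fintype.card Z * N) := by gcongr
  have a3 : δ * N ≤ δ * ((Fintype.card X : ℝ) * (Fintype.card Z * N)) := by
    refine mul_le_mul_of_nonneg_left ?_ hδ
    calc (N : ℝ) = 1 * (1 * N) := by ring
      _ ≤ _ := by gcongr
  have a4 : 0 ≤ 3 * δ * (Fintype.card Y : ℝ) := by positivity
  linarith

/-- A monoid in which the non-units form an ideal is sofic if its group of units is sofic and has
Følner sets of functions separating the points of the orbit of each non-unit. -/
theorem IsSofic.of_units {M : Type u} [Monoid M]
    (hideal : ∀ x y : M, IsUnit (x * y) ↔ IsUnit x ∧ IsUnit y) (hunits : IsSofic Mˣ)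
    (hF : ∀ n : M, ¬ IsUnit n →
      ∃ T : Type u, ∀ [DecidableEq (Mˣ → T)], ∀ (A : Finset Mˣ) (δ : ℝ), 0 < δ →
      ∃ F : Finset (Mˣ → T), F.Nonempty ∧
        (∀ w ∈ F, ∀ u v : Mˣ, w u = w v → n * u = n * v) ∧
        ∀ g ∈ A, ((F.filter fun w => (fun u => w (u * g)) ∉ F).card : ℝ) ≤ δ * F.card) :
    IsSofic M := by
  classical
  refine IsSofic.of_card_le.{u, u} fun K ε hε => ?_
  set A : Finset Mˣ := K.preimage Units.val Units.val_injective.injOn with hA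
  set L : Finset M := K.filter fun n => ¬ IsUnit n with hL
  have hδ : 0 < ε / 3 := by positivity
  obtain ⟨X, _, _, _, act₀, hone₀, hmul₀, hsep₀⟩ := hunits.exists_card_le A hδ
  obtain ⟨Z, _, _, act₁, a, B, hB, hone₁, hgood⟩ := exists_approx_equivariant L
    (fun n hn => hF n (Finset.mem_filter.1 hn).2) A hδ
  -- `Y` holds the images of all points of `Z` under the non-units of `K`; 1 serves as the default
  -- value of `pr`.
  set Y : Finset M := insert 1 ((L ×ˢ (Finset.univ : Finset Z)).image fun p => p.1 * a p.2) with hY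
  have hY1 : (1 : M) ∈ Y := Finset.mem_insert_self _ _
  have hYL : ∀ n ∈ L, ∀ z, n * (a z : M) ∈ Y := fun n hn z =>
    Finset.mem_insert_of_mem (Finset.mem_image.2
      ⟨(n, z), Finset.mk_mem_product hn (Finset.mem_univ _), rfl⟩)
  let pr : M → Y := fun m => if h : m ∈ Y then ⟨m, h⟩ else ⟨1, hY1⟩
  have hpr : ∀ m, m ∈ Y → (pr m : M) = m := fun m hm => by simp only [pr, dif_pos hm]
  -- Enough copies of `X × Z` make `Y` negligible.
  obtain ⟨N, hN⟩ := exists_nat_gt ((Fintype.card Y : ℝ) / (ε / 3))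
  have hYN : (Fintype.card Y : ℝ) ≤ ε / 3 * N := by
    rw [div_lt_iff₀ hδ] at hN
    linarith
  let act : M → (X × Z × Fin N) ⊕ Y → (X × Z × Fin N) ⊕ Y := fun m =>
    Sum.elim (fun q => if h : IsUnit m
        then Sum.inl (act₀ h.unit q.1, act₁ h.unit q.2.1, q.2.2)
        else Sum.inr (pr (m * a q.2.1)))
      (fun y => Sum.inr (pr (m * y)))
  have act_unit : ∀ (g : Mˣ) x z i, act g (Sum.inl (x, z, i)) =
      Sum.inl (act₀ g x, act₁ g z, i) := by
    intro g x z i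
    have : (g.isUnit).unit = g := Units.ext rfl
    simp only [act, Sum.elim_inl, dif_pos g.isUnit, this]
  have act_nonunit : ∀ (n : M), ¬ IsUnit n → ∀ x z i, act n (Sum.inl (x, z, i)) =
      Sum.inr (pr (n * a z)) := by
    intro n hn x z i
    simp only [act, Sum.elim_inl, dif_neg hn]
  have act_inr : ∀ (m : M) y, act m (Sum.inr y) = Sum.inr (pr (m * y)) := fun m y => rfl
  have hcount : ∀ (p : (X × Z × Fin N) ⊕ Y → Prop) [DecidablePred p] (B₀ : Finset X),
      (B₀.card : ℝ) ≤ ε / 3 * Fintype.card X →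
      (∀ x z i, x ∉ B₀ → z ∉ B → ¬ p (Sum.inl (x, z, i))) →
      ((Finset.univ.filter p).card : ℝ) ≤ ε * Fintype.card ((X × Z × Fin N) ⊕ Y) := by
    intro p _ B₀ hB₀ hp
    have := card_filter_sum_le hYN hδ.le p B₀ B hB₀ hB hp
    rwa [mul_div_cancel₀ ε (by norm_num : (3 : ℝ) ≠ 0)] at this
  have hzero : (((∅ : Finset X).card : ℝ)) ≤ ε / 3 * Fintype.card X := by
    rw [Finset.card_empty, Nat.cast_zero]
    positivity
  have memA : ∀ g : Mˣ, (g : M) ∈ K → g ∈ A := fun g hg => Finset.mem_preimage.2 hg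
  have memL : ∀ n ∈ K, ¬ IsUnit n → n ∈ L := fun n hn h => Finset.mem_filter.2 ⟨hn, h⟩
  refine ⟨(X × Z × Fin N) ⊕ Y, inferInstance, inferInstance, ⟨Sum.inr ⟨1, hY1⟩⟩, act, ?_, ?_, ?_⟩
  · rintro (⟨x, z, i⟩ | y)
    · rw [← Units.val_one, act_unit, hone₀, hone₁]
    · rw [act_inr, one_mul]
      exact congrArg Sum.inr (Subtype.ext (hpr y y.2))
  · intro g hg h hh
    by_cases uh : IsUnit h
    · obtain ⟨h, rfl⟩ := uh
      by_cases ug : IsUnit g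
      · obtain ⟨g, rfl⟩ := ug
        refine hcount _ _ (hmul₀ g (memA g hg) h (memA h hh)) fun x z i hx hz => ?_
        rw [not_not, act_unit, act_unit, ← Units.val_mul, act_unit,
          (hgood z hz h (memA h hh)).1 g (memA g hg)]
        have : act₀ g (act₀ h x) = act₀ (g * h) x := by simpa using hx
        rw [this]
      · refine hcount _ _ hzero fun x z i _ hz => ?_
        -- For a non-unit after a unit, the two results agree by approximate equivariance of `a`.
        have ugh : ¬ IsUnit (g * (h : M)) := fun hu => ug ((hideal _ _).1 hu).1
        rw [not_not, act_unit, act_nonunit _ ug, act_nonunit _ ugh,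
          (hgood z hz h (memA h hh)).2 g (memL g hg ug)]
    · refine hcount _ _ hzero fun x z i _ _ => ?_
      -- When h is a non-unit, associativity is exact outside `Y`: the intermediate value h a(z)
      -- already lies in `Y`, so `pr` does not alter it.
      have ugh : ¬ IsUnit (g * h) := fun hu => uh ((hideal _ _).1 hu).2
      rw [not_not, act_nonunit _ uh, act_inr, act_nonunit _ ugh, hpr _ (hYL h (memL h hh uh) z),
        mul_assoc]
  · intro g hg h hh hgh
    by_cases uh : IsUnit h
    · obtain ⟨h, rfl⟩ := uh
      by_cases ug : IsUnit g
      · obtain ⟨g, rfl⟩ := ug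
        refine hcount _ _ (hsep₀ g (memA g hg) h (memA h hh) fun e => hgh (congrArg _ e))
          fun x z i hx _ he => ?_
        rw [act_unit, act_unit, Sum.inl.injEq] at he
        exact hx (by simpa using congrArg Prod.fst he)
      · refine hcount _ _ hzero fun x z i _ _ he => ?_
        rw [act_unit, act_nonunit _ ug] at he
        exact Sum.inr_ne_inl he
    · by_cases ug : IsUnit g
      · obtain ⟨g, rfl⟩ := ug
        refine hcount _ _ hzero fun x z i _ _ he => ?_
        rw [act_unit, act_nonunit _ uh] at he
        exact Sum.inl_ne_inr he
      · refine hcount _ _ hzero fun x z i _ _ he => ?_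
        rw [act_nonunit _ ug, act_nonunit _ uh, Sum.inr.injEq] at he
        have he' := congrArg Subtype.val he
        rw [hpr _ (hYL g (memL g hg ug) z), hpr _ (hYL h (memL h hh uh) z)] at he'
        exact hgh ((a z).isUnit.mul_right_cancel he')

theorem corollary4p3 {M : Type*} [Monoid M]
    (hreg : IsRegularMonoid M)
    (hunits : IsSofic Mˣ)
    (hsub : ∀ (S : Subsemigroup M) (hS : IsSubgroupOf S),
      (∀ x ∈ S, ¬ IsUnit x) → @IsAmenable S hS.group)
    (hfin : ∀ x : M, (classL '' classD x).Finite) :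
    IsSofic M :=
  IsSofic.of_units (fun _ _ => isUnit_mul_iff_of_finite (hfin 1)) hunits
    fun _ hn => exists_folner_of_not_isUnit hreg hsub hfin hn
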